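/- Let $0<\delta<1/3$. Let $S$ be uniform on $\{0,1\}$, and let $X\in\{0,1,e\}$ be $S$ observed through a binary erasure channel with erasure rate $\delta$, so that $P_X(0)=P_X(1)=(1-\delta)/2$ and $P_X(e)=\delta$. The reconstructions are $Z\in\{0,1\}$ for $S$ and $Y\in\{0,1,e\}$ for $X$, with Hamming distortions $\mathsf d_s(s,z)=1\{s\ne z\}$ and $\mathsf d_x(x,y)=1\{x\neq y\}$. Put $\bar{\mathsf d}_s(x,z)=\mathbb E[\mathsf d_s(S,z)\mid X=x]$. The semantic rate-distortion function is $$R(d_s,d_x)=\min_{P_{ZY|X}} I(X;Z,Y)\quad\text{subject to}\quad \mathbb E[\bar{\mathsf d}_s(X,Z)]\le d_s,\ \ \mathbb E[\mathsf d_x(X,Y)]\le d_x .$$ Write $\log$ for the natural logarithm, $h(p)=-p\log p-(1-p)\log(1-p)$ and $H(a,b,c)=-a\log a-b\log b-c\log c$, with $0\log 0=0$. Let $d_s\ge\delta/2$ and $d_x\ge 0$. In each of the following cases the minimum exists, and: (i) If $(d_s,d_x)\in\mathcal D_1$, i.e. $0\le d_x\le 2\delta$ and $d_s\ge d_x/2+\delta/2$,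 then $$R(d_s,d_x)=h(\delta)+(1-\delta)\log 2-h(d_x)-d_x\log 2,$$ achieved by the Markov chain $X-Y^\star-Z^\star$ with $P_{Y^\star}(0)=P_{Y^\star}(1)=\frac{1-\delta-d_x}{2-3d_x}$ and $P_{Y^\star}(e)=\frac{2\delta-d_x}{2-3d_x}$; $P_{X|Y^\star}(x|y)=1-d_x$ if $x=y$ and $d_x/2$ otherwise; $P_{Z^\star|Y^\star}(z|y)=1$ if $z=y$, $1/2$ if $y=e$, and $0$ otherwise. (ii) If $(d_s,d_x)\in\mathcal D_2$, i.e. $2\delta\le d_x\le 1/2+\delta/2$ and $d_s\ge d_x-\delta/2$, then $$R(d_s,d_x)=(1-\delta)\left[\log 2-h\!\left(\tfrac{d_x-\delta}{1-\delta}\right)\right],$$ achieved by the Markov chain $X-Y^\star-Z^\star$ with $P_{Y^\star}(0)=P_{Y^\star}(1)=1/2$ and $P_{Y^\star}(e)=0$; for $y\ne e$, $P_{X|Y^\star}(x|y)=1-d_x$ if $x=y$, $d_x-\delta$ if $x\ne y$ and $x\ne e$, and $\delta$ if $x=e$; for $y\neq e$, $P_{Z^\star|Y^\star}(z|y)=1$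 if $z=y$ and $0$ otherwise. (iii) If $(d_s,d_x)\in\mathcal D_3$, i.e. $d_x\ge d_s+\delta/2$ and $\delta/2\le d_s\le 1/2$, then $$R(d_s,d_x)=(1-\delta)\left[\log 2-h\!\left(\tfrac{d_s-\delta/2}{1-\delta}\right)\right],$$ achieved by the Markov chain $X-Z^\star-Y^\star$ with $P_{Z^\star}(0)=P_{Z^\star}(1)=1/2$; $P_{X|Z^\star}(x|z)=1-d_s-\delta/2$ if $x=z$, $d_s-\delta/2$ if $x\ne z$ and $x\neq e$, and $\delta$ if $x=e$; $P_{Y^\star|Z^\star}(y|z)=1$ if $y=z$ and $0$ otherwise. (iv) If $(d_s,d_x)\in\mathcal D_4$, i.e. $2d_s-\delta\le d_x\le d_s+\delta/2$ and $\delta/2\le d_s\le 3\delta/2$, then $$R(d_s,d_x)=h(\delta)+(1-\delta)\log 2-H\!\left(d_s-\tfrac{\delta}{2},\,d_x-d_s+\tfrac{\delta}{2},\,1-d_x\right),$$ achieved by $P_{Z^\star Y^\star|X}(z,y|x)=P_{Z^\star Y^\star}(z,y)\,g(x)\,c(z,y,x)$. Here the output law $P_{Z^\star Y^\star}(z,y)$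 equals $\frac{\delta+d_x-1}{\delta+4d_x-2d_s-2}$ if $z=y$, $\frac{d_x-d_s-\delta/2}{\delta+4d_x-2d_s-2}$ if $y=e$, and $0$ otherwise; $g(0)=g(1)=\frac{2(1-d_x)}{1-\delta}$ and $g(e)=\frac{1-d_x}{\delta}$; and $c(z,y,x)$ equals $1$ on $\{(0,0,0),(0,e,e),(1,1,1),(1,e,e)\}$, $\frac{d_s-\delta/2}{1-d_x}$ on $\{(0,0,1),(0,e,1),(1,1,0),(1,e,0)\}$, $\frac{\delta/2+d_x-d_s}{1-d_x}$ on $\{(0,0,e),(0,e,0),(1,1,e),(1,e,1)\}$, and $0$ otherwise. (v) If $(d_s,d_x)\in\mathcal D_5$, i.e. $d_x\ge 1/2+\delta/2$ and $d_s\ge 1/2$, then $R(d_s,d_x)=0$. -/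

import Mathlib

noncomputable section

namespace SemanticRD

/-- The marginal law of the observed source `X`, for a joint law `P s x` of `(S, X)`. -/
def marginalX {S X : Type*} [Fintype S] (P : S → X → ℝ) (x : X) : ℝ :=
  ∑ s, P s x

/-- The surrogate distortion `E[d(S, z) | X = x]`. -/
def surrogateDistortion {S X Z : Type*} [Fintype S] (P : S → X → ℝ) (d : S → Z → ℝ)
    (x : X) (z : Z) : ℝ :=
  (∑ s, P s x * d s z) / marginalX P x

/-- `W x (z, y)` is a conditional law of `(Z, Y)` given `X = x`. -/
def IsChannel {X Z Y : Type*} [Fintype Z] [Fintype Y] (W : X → Z × Y → ℝ) : Prop :=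
  ∀ x, W x ∈ stdSimplex ℝ (Z × Y)

/-- The law of the channel output `(Z, Y)` when the input has law `PX`. -/
def outputLaw {X B : Type*} [Fintype X] (PX : X → ℝ) (W : X → B → ℝ) (b : B) : ℝ :=
  ∑ x, PX x * W x b

/-- The mutual information (in nats) between the input of law `PX` and the output of `W`.
A summand with `W x b = 0` vanishes, in accordance with `0 log 0 = 0`. -/
def mutualInfo {X B : Type*} [Fintype X] [Fintype B] (PX : X → ℝ) (W : X → B → ℝ) : ℝ :=
  ∑ x, ∑ b, PX x * W x b * Real.log (W x b / outputLaw PX W b)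

/-- The channel `W` meets both distortion constraints
`E[E[dS(S, Z) | X, Z]] ≤ ds` and `E[dX(X, Y)] ≤ dx`. -/
def IsFeasible {S X Z Y : Type*} [Fintype S] [Fintype X] [Fintype Z] [Fintype Y]
    (P : S → X → ℝ) (dS : S → Z → ℝ) (dX : X → Y → ℝ) (ds dx : ℝ)
    (W : X → Z × Y → ℝ) : Prop :=
  IsChannel W ∧
    ∑ x, ∑ b : Z × Y, marginalX P x * W x b * surrogateDistortion P dS x b.1 ≤ ds ∧
    ∑ x, ∑ b : Z × Y, marginalX P x * W x b * dX x b.2 ≤ dx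

/-- The semantic (noisy) rate-distortion function: the least value of `I(X; Z, Y)` over all
feasible channels from `X` to `(Z, Y)`. -/
def rateDistortion {S X Z Y : Type*} [Fintype S] [Fintype X] [Fintype Z] [Fintype Y]
    (P : S → X → ℝ) (dS : S → Z → ℝ) (dX : X → Y → ℝ) (ds dx : ℝ) : ℝ :=
  sInf ((fun W : X → Z × Y → ℝ => mutualInfo (marginalX P) W) ''
    {W | IsFeasible P dS dX ds dx W})

/-- `W` is an optimal test channel: it is feasible and minimizes `I(X; Z, Y)`. -/
def IsOptimal {S X Z Y : Type*} [Fintype S] [Fintype X] [Fintype Z] [Fintype Y]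
    (P : S → X → ℝ) (dS : S → Z → ℝ) (dX : X → Y → ℝ) (ds dx : ℝ)
    (W : X → Z × Y → ℝ) : Prop :=
  IsFeasible P dS dX ds dx W ∧
    ∀ W' : X → Z × Y → ℝ, IsFeasible P dS dX ds dx W' →
      mutualInfo (marginalX P) W ≤ mutualInfo (marginalX P) W'

/-- `Q x z y` is the joint law of `(X, Z, Y)` under some optimal test channel. -/
def IsOptimalJoint {S X Z Y : Type*} [Fintype S] [Fintype X] [Fintype Z] [Fintype Y]
    (P : S → X → ℝ) (dS : S → Z → ℝ) (dX : X → Y → ℝ) (ds dx : ℝ)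
    (Q : X → Z → Y → ℝ) : Prop :=
  ∃ W : X → Z × Y → ℝ, IsOptimal P dS dX ds dx W ∧
    ∀ x z y, marginalX P x * W x (z, y) = Q x z y

/-- Hamming distortion. -/
def hamming {A : Type*} [DecidableEq A] (a b : A) : ℝ := if a = b then 0 else 1

/-! ### Erased fair coin flips

`Bool` is the alphabet `{0, 1}` (`false` is `0`, `true` is `1`), and `Option Bool` is the
alphabet `{0, 1, e}`, with `none` the erasure symbol `e`. -/

/-- The joint law of `(S, X)`: `S` is a fair bit, and `X` is `S` seen through a binary erasure
channel with erasure rate `δ`. -/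
def efcfLaw (δ : ℝ) (s : Bool) (x : Option Bool) : ℝ :=
  (1 / 2) * (if x = none then δ else if x = some s then 1 - δ else 0)

/-- The semantic rate-distortion function of erased fair coin flips. -/
def efcfR (δ ds dx : ℝ) : ℝ :=
  rateDistortion (efcfLaw δ) (hamming : Bool → Bool → ℝ)
    (hamming : Option Bool → Option Bool → ℝ) ds dx

/-- Optimal test channels for erased fair coin flips. -/
def EfcfOptimal (δ ds dx : ℝ) (W : Option Bool → Bool × Option Bool → ℝ) : Prop :=
  IsOptimal (efcfLaw δ) hamming hamming ds dx W

/-- Joint laws of `(X, Z, Y)` under optimal test channels for erased fair coin flips. -/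
def EfcfOptimalJoint (δ ds dx : ℝ) (Q : Option Bool → Bool → Option Bool → ℝ) : Prop :=
  IsOptimalJoint (efcfLaw δ) hamming hamming ds dx Q

/-- The entropy (in nats) of three masses. -/
def entropy3 (a b c : ℝ) : ℝ := Real.negMulLog a + Real.negMulLog b + Real.negMulLog c

/-! The five regions, as sets of pairs `(ds, dx)`. -/

def D1 (δ : ℝ) : Set (ℝ × ℝ) := {d | 0 ≤ d.2 ∧ d.2 ≤ 2 * δ ∧ d.1 ≥ d.2 / 2 + δ / 2}

def D2 (δ : ℝ) : Set (ℝ × ℝ) :=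
  {d | 2 * δ ≤ d.2 ∧ d.2 ≤ 1 / 2 + δ / 2 ∧ d.1 ≥ d.2 - δ / 2}

def D3 (δ : ℝ) : Set (ℝ × ℝ) := {d | d.2 ≥ d.1 + δ / 2 ∧ δ / 2 ≤ d.1 ∧ d.1 ≤ 1 / 2}

def D4 (δ : ℝ) : Set (ℝ × ℝ) :=
  {d | 2 * d.1 - δ ≤ d.2 ∧ d.2 ≤ d.1 + δ / 2 ∧ δ / 2 ≤ d.1 ∧ d.1 ≤ 3 * δ / 2}

def D5 (δ : ℝ) : Set (ℝ × ℝ) := {d | d.2 ≥ 1 / 2 + δ / 2 ∧ d.1 ≥ 1 / 2}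

/-! Region 1: the Markov chain `X - Y - Z`. -/

def r1Y (δ dx : ℝ) (y : Option Bool) : ℝ :=
  if y = none then (2 * δ - dx) / (2 - 3 * dx) else (1 - δ - dx) / (2 - 3 * dx)

def r1XgivenY (dx : ℝ) (x y : Option Bool) : ℝ :=
  if x = y then 1 - dx else dx / 2

def r1ZgivenY (z : Bool) (y : Option Bool) : ℝ :=
  if y = some z then 1 else if y = none then 1 / 2 else 0

/-! Region 2: the Markov chain `X - Y - Z`. Here `Y = e` has probability `0`, so the conditional
laws given `Y = e` are immaterial; some probability vector is put there. -/

def r2Y (y : Option Bool) : ℝ := if y = none then 0 else 1 / 2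

def r2XgivenY (δ dx : ℝ) (x y : Option Bool) : ℝ :=
  if y = none then 1 / 3
  else if x = none then δ
  else if x = y then 1 - dx
  else dx - δ

def r2ZgivenY (z : Bool) (y : Option Bool) : ℝ :=
  if y = none then 1 / 2 else if y = some z then 1 else 0

/-! Region 3: the Markov chain `X - Z - Y`. -/

def r3Z (_z : Bool) : ℝ := 1 / 2

def r3XgivenZ (δ ds : ℝ) (x : Option Bool) (z : Bool) : ℝ :=
  if x = none then δ else if x = some z then 1 - ds - δ / 2 else ds - δ / 2

def r3YgivenZ (y : Option Bool) (z : Bool) : ℝ := if y = some z then 1 else 0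

/-! Region 4: the channel `P(z, y) g(x) c(z, y, x)`. -/

def r4ZY (δ ds dx : ℝ) (z : Bool) (y : Option Bool) : ℝ :=
  if y = some z then (δ + dx - 1) / (δ + 4 * dx - 2 * ds - 2)
  else if y = none then (dx - ds - δ / 2) / (δ + 4 * dx - 2 * ds - 2)
  else 0

def r4g (δ dx : ℝ) (x : Option Bool) : ℝ :=
  if x = none then (1 - dx) / δ else 2 * (1 - dx) / (1 - δ)

/-- The triples `(0,0,0), (0,e,e), (1,1,1), (1,e,e)`. -/
def G1 : Finset (Bool × Option Bool × Option Bool) :=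
  {(false, some false, some false), (false, none, none),
    (true, some true, some true), (true, none, none)}

/-- The triples `(0,0,1), (0,e,1), (1,1,0), (1,e,0)`. -/
def G2 : Finset (Bool × Option Bool × Option Bool) :=
  {(false, some false, some true), (false, none, some true),
    (true, some true, some false), (true, none, some false)}

/-- The triples `(0,0,e), (0,e,0), (1,1,e), (1,e,1)`. -/
def G3 : Finset (Bool × Option Bool × Option Bool) :=
  {(false, some false, none), (false, none, some false),
    (true, some true, none), (true, none, some true)}

def r4c (δ ds dx : ℝ) (z : Bool) (y x : Option Bool) : ℝ :=
  if (z, y, x) ∈ G1 then 1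
  else if (z, y, x) ∈ G2 then (ds - δ / 2) / (1 - dx)
  else if (z, y, x) ∈ G3 then (δ / 2 + dx - ds) / (1 - dx)
  else 0

def r4Channel (δ ds dx : ℝ) (x : Option Bool) (b : Bool × Option Bool) : ℝ :=
  r4ZY δ ds dx b.1 b.2 * r4g δ dx x * r4c δ ds dx b.1 b.2 x

end SemanticRD

end

open SemanticRD

/-! The rate is a convex minimum, and optimality is certified by Lagrangian duality. For a backward
subkernel `r x b` (nonnegative, with `∑ x, r x b ≤ 1`), the bound `log t ≤ t - 1` gives `I ≥ ∑ P W
log (r / P)`, provided `W` vanishes wherever `r` does (`le_mutualInfo_of_backward`). Equality holds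
when the joint law is `q b * r x b` and `r` is normalised on the support of `q`.

If moreover `log (r / P) = κ x - αs * d̄s - αx * dX` wherever `r ≠ 0`, the lower bound is affine in
the two distortions. With nonnegative multipliers it is then at least `∑ P κ - αs ds - αx dx` on
every feasible channel, and complementary slackness makes the proposed channel attain this value
(`isOptimal_of_certificate`).

Each region therefore reduces to exhibiting `r`, `κ` and the multipliers. Two points need care. For
outputs of probability zero, the exponential form fixes `r`, and its sum over `x` must still be at
most one; in D2 and D4 this is a quadratic inequality that factors through the inequalities bounding
the region. On the edges where a multiplier would be infinite it is set to `0`, and the constraint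
acts by forcing every feasible channel to vanish where `r` does. -/

noncomputable section

namespace SemanticRD

/-! ### Backward-kernel bounds and Lagrangian duality for general alphabets. -/

section General

variable {S X Z Y : Type*} [Fintype S] [Fintype X] [Fintype Z] [Fintype Y]

/-- Any backward subkernel `r` bounds the mutual information from below. -/
theorem le_mutualInfo_of_backward {X B : Type*} [Fintype X] [Fintype B]
    {PX : X → ℝ} (hP : ∀ x, 0 < PX x) {W : X → B → ℝ} (hW : ∀ x b, 0 ≤ W x b)
    {r : X → B → ℝ} (hr : ∀ x b, 0 ≤ r x b) (hr1 : ∀ b, ∑ x, r x b ≤ 1)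
    (habs : ∀ x b, r x b = 0 → W x b = 0) :
    ∑ x, ∑ b, PX x * W x b * Real.log (r x b / PX x) ≤ mutualInfo PX W := by
  have hq : ∀ b, 0 ≤ outputLaw PX W b := fun b =>
    Finset.sum_nonneg fun x _ => mul_nonneg (hP x).le (hW x b)
  -- The term `P W - q r` is the loss in `log t ≤ t - 1` at `t = q r / (P W)`, multiplied by `P W`.
  have key : ∀ x b, PX x * W x b * Real.log (r x b / PX x)
      + (PX x * W x b - outputLaw PX W b * r x b)
      ≤ PX x * W x b * Real.log (W x b / outputLaw PX W b) := by
    intro x b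
    rcases (hW x b).eq_or_lt with h0 | hpos
    · have := mul_nonneg (hq b) (hr x b)
      simp only [← h0]
      linarith
    -- Since `Real.log 0 = 0` rather than `-∞`, a point with `r = 0 < W` could break the bound;
    -- `habs` rules it out.
    · have hrpos : 0 < r x b := lt_of_le_of_ne (hr x b) fun h => hpos.ne' (habs x b h.symm)
      have hPW : 0 < PX x * W x b := mul_pos (hP x) hpos
      have hqpos : 0 < outputLaw PX W b := hPW.trans_le <|
        Finset.single_le_sum (f := fun x => PX x * W x b)
          (fun i _ => mul_nonneg (hP i).le (hW i b)) (Finset.mem_univ x)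
      have hlog := Real.log_le_sub_one_of_pos
        (show 0 < outputLaw PX W b * r x b / (PX x * W x b) by positivity)
      rw [Real.log_div (by positivity) (by positivity), Real.log_mul hqpos.ne' hrpos.ne',
        Real.log_mul (hP x).ne' hpos.ne'] at hlog
      have := mul_le_mul_of_nonneg_left hlog hPW.le
      rw [mul_sub (PX x * W x b) (_ / _), mul_div_cancel₀ _ hPW.ne'] at this
      rw [Real.log_div hrpos.ne' (hP x).ne', Real.log_div hpos.ne' hqpos.ne']
      linarith
  have hsum := Finset.sum_le_sum fun x (_ : x ∈ Finset.univ) =>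
    Finset.sum_le_sum fun b (_ : b ∈ Finset.univ) => key x b
  -- For fixed `b` the sum over `x` is `q b * (1 - ∑ x, r x b)`, so subnormalisation is enough.
  have hnn : 0 ≤ ∑ x, ∑ b, (PX x * W x b - outputLaw PX W b * r x b) := by
    rw [Finset.sum_comm]
    refine Finset.sum_nonneg fun b _ => ?_
    rw [Finset.sum_sub_distrib, ← Finset.mul_sum]
    have := mul_le_mul_of_nonneg_left (hr1 b) (hq b)
    change 0 ≤ outputLaw PX W b - _
    linarith
  simp only [Finset.sum_add_distrib] at hsum
  unfold mutualInfo
  linarith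

/-- The output law of a channel whose joint law factors through a backward kernel. -/
theorem outputLaw_eq_of_backward {X B : Type*} [Fintype X] [Fintype B]
    {PX : X → ℝ} {W r : X → B → ℝ} {q : B → ℝ}
    (hfact : ∀ x b, PX x * W x b = q b * r x b) (hq : ∀ b, q b ≠ 0 → ∑ x, r x b = 1) (b : B) :
    outputLaw PX W b = q b := by
  unfold outputLaw
  simp only [hfact, ← Finset.mul_sum]
  by_cases h : q b = 0
  · simp [h]
  · rw [hq b h, mul_one]

/-- A backward kernel computes the mutual information exactly. -/
theorem mutualInfo_eq_of_backward {X B : Type*} [Fintype X] [Fintype B]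
    {PX : X → ℝ} (hP : ∀ x, 0 < PX x) {W r : X → B → ℝ} {q : B → ℝ}
    (hfact : ∀ x b, PX x * W x b = q b * r x b) (hq : ∀ b, q b ≠ 0 → ∑ x, r x b = 1) :
    mutualInfo PX W = ∑ x, ∑ b, PX x * W x b * Real.log (r x b / PX x) := by
  unfold mutualInfo
  refine Finset.sum_congr rfl fun x _ => Finset.sum_congr rfl fun b _ => ?_
  rw [outputLaw_eq_of_backward hfact hq]
  by_cases h : q b = 0
  · simp [hfact, h]
  · have : W x b / q b = r x b / PX x := by
      rw [div_eq_div_iff h (hP x).ne']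
      linarith [hfact x b]
    rw [this]

/-- Evaluation of the dual functional on a channel supported where `r` does not vanish. -/
theorem sum_log_backward {P : S → X → ℝ} {dS : S → Z → ℝ} {dX : X → Y → ℝ}
    {W r : X → Z × Y → ℝ} {κ : X → ℝ} {αs αx : ℝ} (hW : IsChannel W)
    (habs : ∀ x b, r x b = 0 → marginalX P x * W x b = 0)
    (hlog : ∀ x b, r x b ≠ 0 → Real.log (r x b / marginalX P x)
      = κ x - αs * surrogateDistortion P dS x b.1 - αx * dX x b.2) :
    ∑ x, ∑ b, marginalX P x * W x b * Real.log (r x b / marginalX P x)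
      = ∑ x, marginalX P x * κ x
        - αs * ∑ x, ∑ b : Z × Y, marginalX P x * W x b * surrogateDistortion P dS x b.1
        - αx * ∑ x, ∑ b : Z × Y, marginalX P x * W x b * dX x b.2 := by
  have h1 : ∑ x, marginalX P x * κ x = ∑ x, ∑ b, marginalX P x * W x b * κ x := by
    refine Finset.sum_congr rfl fun x _ => ?_
    rw [← Finset.sum_mul, ← Finset.mul_sum, (hW x).2, mul_one]
  simp only [h1, Finset.mul_sum, ← Finset.sum_sub_distrib]
  refine Finset.sum_congr rfl fun x _ => Finset.sum_congr rfl fun b _ => ?_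
  by_cases h : r x b = 0
  · simp [habs x b h]
  · rw [hlog x b h]
    ring

/-- Lagrangian duality: a backward kernel of exponential form, with complementary slackness,
certifies optimality of a test channel. -/
theorem isOptimal_of_certificate {P : S → X → ℝ} {dS : S → Z → ℝ} {dX : X → Y → ℝ}
    {ds dx : ℝ} (hP : ∀ x, 0 < marginalX P x) {W r : X → Z × Y → ℝ} {q : Z × Y → ℝ}
    {κ : X → ℝ} {αs αx : ℝ} (hαs : 0 ≤ αs) (hαx : 0 ≤ αx)
    (hfeas : IsFeasible P dS dX ds dx W)
    (hfact : ∀ x b, marginalX P x * W x b = q b * r x b)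
    (hq : ∀ b, q b ≠ 0 → ∑ x, r x b = 1)
    (hr : ∀ x b, 0 ≤ r x b) (hr1 : ∀ b, ∑ x, r x b ≤ 1)
    (hlog : ∀ x b, r x b ≠ 0 → Real.log (r x b / marginalX P x)
      = κ x - αs * surrogateDistortion P dS x b.1 - αx * dX x b.2)
    (hs : αs = 0 ∨
      ∑ x, ∑ b : Z × Y, marginalX P x * W x b * surrogateDistortion P dS x b.1 = ds)
    (hx : αx = 0 ∨ ∑ x, ∑ b : Z × Y, marginalX P x * W x b * dX x b.2 = dx)
    (habs : ∀ W' : X → Z × Y → ℝ, IsFeasible P dS dX ds dx W' →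
      ∀ x b, r x b = 0 → W' x b = 0) :
    IsOptimal P dS dX ds dx W ∧
      rateDistortion P dS dX ds dx = ∑ x, marginalX P x * κ x - αs * ds - αx * dx := by
  have hval : mutualInfo (marginalX P) W
      = ∑ x, marginalX P x * κ x - αs * ds - αx * dx := by
    rw [mutualInfo_eq_of_backward hP hfact hq,
      sum_log_backward hfeas.1 (fun x b h => by rw [hfact, h, mul_zero]) hlog]
    rcases hs with hs | hs <;> rcases hx with hx | hx <;> simp [hs, hx]
  have hle : ∀ W' : X → Z × Y → ℝ, IsFeasible P dS dX ds dx W' →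
      mutualInfo (marginalX P) W ≤ mutualInfo (marginalX P) W' := by
    intro W' hW'
    have h := le_mutualInfo_of_backward hP (fun x b => (hW'.1 x).1 b) hr hr1 (habs W' hW')
    rw [sum_log_backward hW'.1 (fun x b h => by rw [habs W' hW' x b h, mul_zero]) hlog] at h
    have h1 := mul_le_mul_of_nonneg_left hW'.2.1 hαs
    have h2 := mul_le_mul_of_nonneg_left hW'.2.2 hαx
    linarith
  refine ⟨⟨hfeas, hle⟩, ?_⟩
  rw [← hval]
  refine IsLeast.csInf_eq ⟨⟨W, hfeas, rfl⟩, ?_⟩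
  rintro _ ⟨W', hW', rfl⟩
  exact hle W' hW'

end General

/-! ### The erased fair coin: distortions, forced zeros and the specialised certificate. -/

section Efcf

variable {δ ds dx : ℝ}

@[simp] theorem marginalX_efcf_none (δ : ℝ) : marginalX (efcfLaw δ) none = δ := by
  simp [marginalX, efcfLaw]

@[simp] theorem marginalX_efcf_some (δ : ℝ) (a : Bool) :
    marginalX (efcfLaw δ) (some a) = (1 - δ) / 2 := by
  cases a <;> simp [marginalX, efcfLaw] <;> ring

theorem marginalX_efcf_pos (hδ0 : 0 < δ) (hδ : δ < 1) (x : Option Bool) :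
    0 < marginalX (efcfLaw δ) x := by
  cases x
  · simpa
  · simp; linarith

theorem surrogate_efcf_none (hδ0 : 0 < δ) (z : Bool) :
    surrogateDistortion (efcfLaw δ) hamming none z = 1 / 2 := by
  have := hδ0.ne'
  cases z <;> simp [surrogateDistortion, efcfLaw, hamming] <;> field_simp

theorem surrogate_efcf_some (hδ : δ < 1) (a z : Bool) :
    surrogateDistortion (efcfLaw δ) hamming (some a) z = if a = z then 0 else 1 := by
  have : 1 - δ ≠ 0 := by linarith
  cases a <;> cases z <;> simp [surrogateDistortion, efcfLaw, hamming] <;> field_simp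

/-- The expected semantic distortion, written out. -/
theorem sum_surrogate_efcf (hδ0 : 0 < δ) (hδ : δ < 1) (W : Option Bool → Bool × Option Bool → ℝ) :
    ∑ x, ∑ b : Bool × Option Bool, marginalX (efcfLaw δ) x * W x b
        * surrogateDistortion (efcfLaw δ) hamming x b.1
      = δ / 2 * (∑ b, W none b)
        + (1 - δ) / 2 * ((∑ y, W (some false) (true, y)) + ∑ y, W (some true) (false, y)) := by
  simp [Fintype.sum_option, Fintype.sum_prod_type, surrogate_efcf_none hδ0,
    surrogate_efcf_some hδ]
  ring

theorem sum_hamming_efcf (W : Option Bool → Bool × Option Bool → ℝ) :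
    ∑ x, ∑ b : Bool × Option Bool, marginalX (efcfLaw δ) x * W x b
        * (hamming x b.2 : ℝ)
      = ∑ z, (δ * (W none (z, some false) + W none (z, some true))
        + (1 - δ) / 2 * (W (some false) (z, none) + W (some false) (z, some true)
          + W (some true) (z, none) + W (some true) (z, some false))) := by
  simp [Fintype.sum_option, Fintype.sum_prod_type, hamming]
  ring

/-- A channel of least semantic distortion never misreads an unerased symbol. -/
theorem channel_eq_zero_of_semantic (hδ0 : 0 < δ) (hδ : δ < 1)
    {W : Option Bool → Bool × Option Bool → ℝ}
    (hW : IsFeasible (efcfLaw δ) hamming (hamming : Option Bool → Option Bool → ℝ) ds dx W)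
    (hds : ds ≤ δ / 2) {a z : Bool} (haz : a ≠ z) (y : Option Bool) :
    W (some a) (z, y) = 0 := by
  have h := hW.2.1
  rw [sum_surrogate_efcf hδ0 hδ, (hW.1 none).2] at h
  have hn : ∀ a z, 0 ≤ ∑ y, W (some a) (z, y) := fun a z =>
    Finset.sum_nonneg fun y _ => (hW.1 (some a)).1 (z, y)
  have hle : W (some a) (z, y) ≤ ∑ y, W (some a) (z, y) :=
    Finset.single_le_sum (f := fun y => W (some a) (z, y))
      (fun y _ => (hW.1 (some a)).1 (z, y)) (Finset.mem_univ y)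
  have h0 := (hW.1 (some a)).1 (z, y)
  -- Erasures alone cost `δ / 2` whatever `Z` is, so the budget leaves nothing for misread symbols.
  have h3 : (∑ y, W (some false) (true, y)) + ∑ y, W (some true) (false, y) ≤ 0 := by
    by_contra hc
    push Not at hc
    have := mul_pos (show 0 < (1 - δ) / 2 by linarith) hc
    linarith
  have h1 := hn false true
  have h2 := hn true false
  cases a <;> cases z <;> simp at haz <;> linarith

theorem channel_eq_zero_of_hamming (hδ0 : 0 < δ) (hδ : δ < 1)
    {W : Option Bool → Bool × Option Bool → ℝ}
    (hW : IsFeasible (efcfLaw δ) hamming (hamming : Option Bool → Option Bool → ℝ) ds dx W)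
    (hdx : dx ≤ 0) {x y : Option Bool} (hxy : x ≠ y) (z : Bool) :
    W x (z, y) = 0 := by
  have hnn : ∀ x, ∀ b : Bool × Option Bool,
      0 ≤ marginalX (efcfLaw δ) x * W x b * (hamming x b.2 : ℝ) := fun x b =>
    mul_nonneg (mul_nonneg (marginalX_efcf_pos hδ0 hδ x).le ((hW.1 x).1 b))
      (by unfold hamming; split_ifs <;> norm_num)
  have h0 : ∑ x, ∑ b : Bool × Option Bool,
      marginalX (efcfLaw δ) x * W x b * (hamming x b.2 : ℝ) = 0 :=
    le_antisymm (hW.2.2.trans hdx) (Finset.sum_nonneg fun x _ => Finset.sum_nonneg fun b _ => hnn x b)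
  rw [Finset.sum_eq_zero_iff_of_nonneg
    fun x _ => Finset.sum_nonneg fun b _ => hnn x b] at h0
  have h1 := h0 x (Finset.mem_univ x)
  rw [Finset.sum_eq_zero_iff_of_nonneg fun b _ => hnn x b] at h1
  have h2 := h1 (z, y) (Finset.mem_univ _)
  simpa [hamming, hxy, (marginalX_efcf_pos hδ0 hδ x).ne'] using h2

/-- The source entropy. -/
theorem efcf_entropy (hδ : δ < 1) :
    -(δ * Real.log δ) - (1 - δ) * Real.log ((1 - δ) / 2)
      = Real.binEntropy δ + (1 - δ) * Real.log 2 := by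
  rw [Real.log_div (by linarith) (by norm_num), Real.binEntropy_eq_negMulLog_add_negMulLog_one_sub]
  simp only [Real.negMulLog]
  ring

/-- Optimality certificate for erased fair coin flips, in terms of a joint law `q b * r x b`. -/
theorem efcfOptimalJoint_of_certificate (hδ0 : 0 < δ) (hδ : δ < 1)
    {Q : Option Bool → Bool → Option Bool → ℝ}
    {r : Option Bool → Bool × Option Bool → ℝ} {q : Bool × Option Bool → ℝ}
    {κ : Option Bool → ℝ} {αs αx : ℝ} (hαs : 0 ≤ αs) (hαx : 0 ≤ αx)
    (hQ : ∀ x z y, Q x z y = q (z, y) * r x (z, y))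
    (hq0 : ∀ b, 0 ≤ q b)
    (hq : ∀ b, q b ≠ 0 → ∑ x, r x b = 1)
    (hr : ∀ x b, 0 ≤ r x b) (hr1 : ∀ b, ∑ x, r x b ≤ 1)
    (hmarg : ∀ x, ∑ b, q b * r x b = marginalX (efcfLaw δ) x)
    (hlog : ∀ x b, r x b ≠ 0 → Real.log (r x b / marginalX (efcfLaw δ) x)
      = κ x - αs * surrogateDistortion (efcfLaw δ) hamming x b.1 - αx * hamming x b.2)
    (hsle : ∑ x, ∑ b : Bool × Option Bool,
      q b * r x b * surrogateDistortion (efcfLaw δ) hamming x b.1 ≤ ds)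
    (hxle : ∑ x, ∑ b : Bool × Option Bool, q b * r x b * hamming x b.2 ≤ dx)
    (hs : αs = 0 ∨ ∑ x, ∑ b : Bool × Option Bool,
      q b * r x b * surrogateDistortion (efcfLaw δ) hamming x b.1 = ds)
    (hx : αx = 0 ∨ ∑ x, ∑ b : Bool × Option Bool, q b * r x b * hamming x b.2 = dx)
    (habs : ∀ W' : Option Bool → Bool × Option Bool → ℝ,
      IsFeasible (efcfLaw δ) hamming (hamming : Option Bool → Option Bool → ℝ) ds dx W' →
      ∀ x b, r x b = 0 → W' x b = 0) :
    efcfR δ ds dx = ∑ x, marginalX (efcfLaw δ) x * κ x - αs * ds - αx * dx ∧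
      EfcfOptimalJoint δ ds dx Q := by
  have hP := marginalX_efcf_pos hδ0 hδ
  have hfact : ∀ x b, marginalX (efcfLaw δ) x * (q b * r x b / marginalX (efcfLaw δ) x)
      = q b * r x b := fun x b => mul_div_cancel₀ _ (hP x).ne'
  have hfeas : IsFeasible (efcfLaw δ) hamming (hamming : Option Bool → Option Bool → ℝ) ds dx
      (fun x b => q b * r x b / marginalX (efcfLaw δ) x) := by
    refine ⟨fun x => ⟨fun b => div_nonneg (mul_nonneg (hq0 b) (hr x b)) (hP x).le, ?_⟩, ?_, ?_⟩
    · rw [← Finset.sum_div, hmarg, div_self (hP x).ne']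
    · simpa only [hfact] using hsle
    · simpa only [hfact] using hxle
  obtain ⟨h1, h2⟩ := isOptimal_of_certificate hP hαs hαx hfeas hfact hq hr hr1 hlog
    (by simpa only [hfact] using hs) (by simpa only [hfact] using hx) habs
  exact ⟨h2, _, h1, fun x z y => by rw [hQ, hfact]⟩

/-! ### Certificates with one active distortion constraint (D1, D2, D3) or none (D5). -/

theorem efcf_region1 (hδ0 : 0 < δ) (hδ : δ < 1 / 3) (h : (ds, dx) ∈ D1 δ) :
    efcfR δ ds dx = Real.binEntropy δ + (1 - δ) * Real.log 2
        - Real.binEntropy dx - dx * Real.log 2 ∧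
    EfcfOptimalJoint δ ds dx
      (fun x z y => r1Y δ dx y * r1XgivenY dx x y * r1ZgivenY z y) := by
  obtain ⟨h0, h1, h2⟩ := h
  simp only at h0 h1 h2
  have hδ1 : δ < 1 := by linarith
  have hD : 0 < 2 - 3 * dx := by linarith
  have hD' : 2 - dx * 3 ≠ 0 := by linarith
  have hc : 0 < 1 - dx := by linarith
  have hsum : ∀ b : Bool × Option Bool, ∑ x, r1XgivenY dx x b.2 = 1 := by
    rintro ⟨z, y⟩
    cases y with
    | none => simp [r1XgivenY, Fintype.sum_option]; ring
    | some a => cases a <;> simp [r1XgivenY, Fintype.sum_option] <;> ring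
  obtain ⟨hR, hopt⟩ := efcfOptimalJoint_of_certificate (ds := ds) (dx := dx) hδ0 hδ1
    (Q := fun x z y => r1Y δ dx y * r1XgivenY dx x y * r1ZgivenY z y)
    (r := fun x b => r1XgivenY dx x b.2) (q := fun b => r1Y δ dx b.2 * r1ZgivenY b.1 b.2)
    (κ := fun x => Real.log (1 - dx) - Real.log (marginalX (efcfLaw δ) x))
    -- The semantic constraint is implied, hence `αs = 0`. Each Hamming error multiplies `r` by `(dx
    -- / 2) / (1 - dx)`, which dictates `αx`; at `dx = 0` this multiplier would be infinite, and
    -- `channel_eq_zero_of_hamming` takes its place.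
    (αs := 0) (αx := if dx = 0 then 0 else Real.log (1 - dx) - Real.log (dx / 2)) le_rfl
    (by
      split_ifs with h
      · exact le_rfl
      · have : 0 < dx := lt_of_le_of_ne h0 (Ne.symm h)
        exact sub_nonneg.2 (Real.log_le_log (by linarith) (by linarith)))
    (fun x z y => by ring)
    (by
      rintro ⟨z, y⟩
      refine mul_nonneg ?_ ?_
      · unfold r1Y
        split_ifs <;> exact div_nonneg (by linarith) hD.le
      · unfold r1ZgivenY
        split_ifs <;> norm_num)
    (fun b _ => hsum b)
    (by
      intro x b
      unfold r1XgivenY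
      split_ifs <;> linarith)
    (fun b => (hsum b).le)
    (by
      rintro (_ | _ | _) <;>
        simp [Fintype.sum_prod_type, Fintype.sum_option, r1Y, r1ZgivenY, r1XgivenY] <;>
        field_simp <;> ring)
    (by
      intro x b hne
      have hP := (marginalX_efcf_pos hδ0 hδ1 x).ne'
      rw [Real.log_div hne hP]
      unfold r1XgivenY hamming at *
      by_cases hxb : x = b.2
      · simp [hxb]
      · simp only [hxb, if_false] at hne ⊢
        have : dx ≠ 0 := fun h => hne (by simp [h])
        simp only [this, if_false]
        ring)
    (by
      refine le_trans (le_of_eq ?_) h2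
      simp [Fintype.sum_prod_type, Fintype.sum_option, r1Y, r1ZgivenY, r1XgivenY,
        surrogate_efcf_none hδ0, surrogate_efcf_some hδ1]
      field_simp
      ring)
    (by
      refine le_of_eq ?_
      simp [Fintype.sum_prod_type, Fintype.sum_option, r1Y, r1ZgivenY, r1XgivenY, hamming]
      field_simp
      ring)
    (Or.inl rfl)
    (Or.inr (by
      simp [Fintype.sum_prod_type, Fintype.sum_option, r1Y, r1ZgivenY, r1XgivenY, hamming]
      field_simp
      ring))
    (by
      rintro W' hW' x ⟨z, y⟩ h
      unfold r1XgivenY at h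
      split_ifs at h with hxy
      · linarith
      · exact channel_eq_zero_of_hamming hδ0 hδ1 hW' (by linarith) hxy z)
  refine ⟨?_, hopt⟩
  rw [hR, ← efcf_entropy hδ1, Real.binEntropy_eq_negMulLog_add_negMulLog_one_sub]
  simp only [Fintype.sum_option, Fintype.sum_bool, marginalX_efcf_none, marginalX_efcf_some,
    Real.negMulLog]
  split_ifs with h
  · simp [h]; ring
  · rw [Real.log_div h (by norm_num)]
    ring

theorem efcf_region2 (hδ0 : 0 < δ) (hδ : δ < 1 / 3) (h : (ds, dx) ∈ D2 δ) :
    efcfR δ ds dx = (1 - δ) * (Real.log 2 - Real.binEntropy ((dx - δ) / (1 - δ))) ∧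
    EfcfOptimalJoint δ ds dx
      (fun x z y => r2Y y * r2XgivenY δ dx x y * r2ZgivenY z y) := by
  obtain ⟨h0, h1, h2⟩ := h
  simp only at h0 h1 h2
  have hδ1 : δ < 1 := by linarith
  have ht : 0 < dx - δ := by linarith
  have hc : 0 < 1 - dx := by linarith
  have h1δ : 0 < 1 - δ := by linarith
  -- After clearing the denominator this is `0 ≤ (dx - 2 * δ) * (1 + δ - 2 * dx)`, the product of
  -- the slacks in the two bounds on `dx` up to a factor `2`.
  have hmain : δ * (1 - dx) / (dx - δ) + 2 * (dx - δ) ≤ 1 := by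
    rw [div_add' _ _ _ ht.ne', div_le_one ht]
    nlinarith [mul_nonneg (sub_nonneg.2 h0) (sub_nonneg.2 h1)]
  obtain ⟨hR, hopt⟩ := efcfOptimalJoint_of_certificate (ds := ds) (dx := dx) hδ0 hδ1
    (Q := fun x z y => r2Y y * r2XgivenY δ dx x y * r2ZgivenY z y)
    (r := fun x b => if b.2 = none then
        (if x = none then δ * (1 - dx) / (dx - δ) else dx - δ) else r2XgivenY δ dx x b.2)
    (q := fun b => r2Y b.2 * r2ZgivenY b.1 b.2)
    (κ := fun x => (if x = none then Real.log (δ * (1 - dx) / (dx - δ)) else Real.log (1 - dx))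
      - Real.log (marginalX (efcfLaw δ) x))
    (αs := 0) (αx := Real.log (1 - dx) - Real.log (dx - δ)) le_rfl
    (sub_nonneg.2 (Real.log_le_log ht (by linarith)))
    (by
      intro x z y
      cases y <;> simp [r2Y]
      ring)
    (by
      rintro ⟨z, y⟩
      refine mul_nonneg ?_ ?_
      · unfold r2Y
        split_ifs <;> norm_num
      · unfold r2ZgivenY
        split_ifs <;> norm_num)
    (by
      rintro ⟨z, _ | _ | _⟩ hb
      · simp [r2Y] at hb
      all_goals
        simp [r2XgivenY, Fintype.sum_option]
        try ring)
    (by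
      rintro x ⟨z, y⟩
      dsimp only
      unfold r2XgivenY
      split_ifs <;> positivity)
    (by
      rintro ⟨z, _ | _ | _⟩ <;> simp [r2XgivenY, Fintype.sum_option] <;> linarith)
    (by
      rintro (_ | _ | _) <;>
        simp [Fintype.sum_prod_type, Fintype.sum_option, r2Y, r2ZgivenY, r2XgivenY] <;>
        ring)
    (by
      rintro x b hne
      have hP := (marginalX_efcf_pos hδ0 hδ1 x).ne'
      rw [Real.log_div hne hP]
      have hlog : Real.log (δ * (1 - dx) / (dx - δ))
          = Real.log δ + Real.log (1 - dx) - Real.log (dx - δ) := by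
        rw [Real.log_div (by positivity) ht.ne', Real.log_mul hδ0.ne' hc.ne']
      obtain ⟨z, y⟩ := b
      rcases x with _ | _ | _ <;> rcases y with _ | _ | _ <;>
        simp [r2XgivenY, hamming, hlog]
      all_goals ring)
    (by
      refine le_trans (le_of_eq ?_) h2
      simp [Fintype.sum_prod_type, Fintype.sum_option, r2Y, r2ZgivenY, r2XgivenY,
        surrogate_efcf_none hδ0, surrogate_efcf_some hδ1]
      ring)
    (by
      refine le_of_eq ?_
      simp [Fintype.sum_prod_type, Fintype.sum_option, r2Y, r2ZgivenY, r2XgivenY, hamming]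
      ring)
    (Or.inl rfl)
    (Or.inr (by
      simp [Fintype.sum_prod_type, Fintype.sum_option, r2Y, r2ZgivenY, r2XgivenY, hamming]
      ring))
    (by
      rintro W' hW' x ⟨z, y⟩ h
      exfalso
      revert h
      dsimp only
      unfold r2XgivenY
      split_ifs <;> positivity)
  refine ⟨?_, hopt⟩
  have hsub : 1 - (dx - δ) / (1 - δ) = (1 - dx) / (1 - δ) := by
    field_simp
    ring
  rw [hR, Real.binEntropy_eq_negMulLog_add_negMulLog_one_sub, hsub]
  simp only [Fintype.sum_option, Fintype.sum_bool, marginalX_efcf_none, marginalX_efcf_some,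
    Real.negMulLog, reduceCtorEq, if_true, if_false]
  rw [Real.log_div (by positivity) ht.ne', Real.log_mul hδ0.ne' hc.ne',
    Real.log_div h1δ.ne' (by norm_num), Real.log_div ht.ne' h1δ.ne',
    Real.log_div hc.ne' h1δ.ne']
  field_simp
  ring

theorem efcf_region3 (hδ0 : 0 < δ) (hδ : δ < 1 / 3) (h : (ds, dx) ∈ D3 δ) :
    efcfR δ ds dx = (1 - δ) * (Real.log 2 - Real.binEntropy ((ds - δ / 2) / (1 - δ))) ∧
    EfcfOptimalJoint δ ds dx
      (fun x z y => r3Z z * r3XgivenZ δ ds x z * r3YgivenZ y z) := by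
  obtain ⟨h0, h1, h2⟩ := h
  simp only at h0 h1 h2
  have hδ1 : δ < 1 := by linarith
  have hc : 0 < 1 - ds - δ / 2 := by linarith
  have h1δ : 0 < 1 - δ := by linarith
  have hsum : ∀ b : Bool × Option Bool, ∑ x, r3XgivenZ δ ds x b.1 = 1 := by
    rintro ⟨_ | _, y⟩ <;> simp [r3XgivenZ, Fintype.sum_option] <;> ring
  obtain ⟨hR, hopt⟩ := efcfOptimalJoint_of_certificate (ds := ds) (dx := dx) hδ0 hδ1
    (Q := fun x z y => r3Z z * r3XgivenZ δ ds x z * r3YgivenZ y z)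
    (r := fun x b => r3XgivenZ δ ds x b.1) (q := fun b => r3Z b.1 * r3YgivenZ b.2 b.1)
    -- The multiplier is the log-ratio of correct to misread unerased symbols, infinite and replaced
    -- by `0` at `ds = δ / 2`. As `d̄s(e, z) = 1 / 2` for both `z`, `κ` at the erasure carries a
    -- compensating `αs / 2`.
    (αs := if ds - δ / 2 = 0 then 0 else Real.log (1 - ds - δ / 2) - Real.log (ds - δ / 2))
    (κ := fun x => (if x = none then Real.log δ +
        (if ds - δ / 2 = 0 then 0 else Real.log (1 - ds - δ / 2) - Real.log (ds - δ / 2)) / 2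
        else Real.log (1 - ds - δ / 2)) - Real.log (marginalX (efcfLaw δ) x))
    (αx := 0)
    (by
      split_ifs with h
      · exact le_rfl
      · have : 0 < ds - δ / 2 := lt_of_le_of_ne (by linarith) (Ne.symm h)
        exact sub_nonneg.2 (Real.log_le_log (by linarith) (by linarith))) le_rfl
    (fun x z y => by ring)
    (by
      rintro ⟨z, y⟩
      refine mul_nonneg ?_ ?_
      · unfold r3Z
        norm_num
      · unfold r3YgivenZ
        split_ifs <;> norm_num)
    (fun b _ => hsum b)
    (by
      intro x b
      unfold r3XgivenZ
      split_ifs <;> linarith)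
    (fun b => (hsum b).le)
    (by
      rintro (_ | _ | _) <;>
        simp [Fintype.sum_prod_type, r3Z, r3XgivenZ, r3YgivenZ] <;>
        ring)
    (by
      rintro x ⟨z, y⟩ hne
      have hP := (marginalX_efcf_pos hδ0 hδ1 x).ne'
      rw [Real.log_div hne hP]
      rcases x with _ | a
      · rw [surrogate_efcf_none hδ0]
        simp only [r3XgivenZ, if_true]
        ring
      · rw [surrogate_efcf_some hδ1]
        unfold r3XgivenZ at *
        by_cases haz : a = z
        · simp [haz]
        · simp only [reduceCtorEq, if_false, Option.some.injEq, haz] at hne ⊢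
          simp only [hne, if_false]
          ring)
    (by
      refine le_of_eq ?_
      simp [Fintype.sum_prod_type, Fintype.sum_option, r3Z, r3XgivenZ, r3YgivenZ,
        surrogate_efcf_none hδ0, surrogate_efcf_some hδ1]
      ring)
    (by
      refine le_trans (le_of_eq ?_) h0
      simp [Fintype.sum_prod_type, Fintype.sum_option, r3Z, r3XgivenZ, r3YgivenZ, hamming]
      ring)
    (Or.inr (by
      simp [Fintype.sum_prod_type, Fintype.sum_option, r3Z, r3XgivenZ, r3YgivenZ,
        surrogate_efcf_none hδ0, surrogate_efcf_some hδ1]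
      ring))
    (Or.inl rfl)
    (by
      rintro W' hW' x ⟨z, y⟩ h
      unfold r3XgivenZ at h
      split_ifs at h with h3 h4
      · linarith
      · linarith
      -- Here `ds = δ / 2`, the only case in which `r` has zeros.
      · obtain ⟨a, rfl⟩ := Option.ne_none_iff_exists'.1 h3
        exact channel_eq_zero_of_semantic hδ0 hδ1 hW' (by linarith)
          (fun e => h4 (by rw [e])) y)
  refine ⟨?_, hopt⟩
  have hsub : 1 - (ds - δ / 2) / (1 - δ) = (1 - ds - δ / 2) / (1 - δ) := by
    field_simp
    ring
  rw [hR, Real.binEntropy_eq_negMulLog_add_negMulLog_one_sub, hsub]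
  simp only [Fintype.sum_option, Fintype.sum_bool, marginalX_efcf_none, marginalX_efcf_some,
    Real.negMulLog, reduceCtorEq, if_true, if_false]
  rw [Real.log_div h1δ.ne' (by norm_num), Real.log_div hc.ne' h1δ.ne']
  split_ifs with h
  · have : ds = δ / 2 := by linarith
    subst this
    have : 1 - δ / 2 - δ / 2 = 1 - δ := by ring
    simp [this]
    ring
  · rw [Real.log_div h h1δ.ne']
    field_simp
    ring

theorem efcf_region5 (hδ0 : 0 < δ) (hδ : δ < 1 / 3) (h : (ds, dx) ∈ D5 δ) :
    efcfR δ ds dx = 0 ∧ ∃ W, EfcfOptimal δ ds dx W := by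
  obtain ⟨h1, h2⟩ := h
  simp only at h1 h2
  have hδ1 : δ < 1 := by linarith
  have hP := marginalX_efcf_pos hδ0 hδ1
  have hsum : ∑ x, marginalX (efcfLaw δ) x = 1 := by
    simp [Fintype.sum_option]
    ring
  obtain ⟨hR, W, hW, -⟩ := efcfOptimalJoint_of_certificate (ds := ds) (dx := dx) hδ0 hδ1
    (Q := fun x z y => (if z = false ∧ y = some false then 1 else 0) * marginalX (efcfLaw δ) x)
    -- Independence: the constant output `(0, 0)` already meets both constraints, so the backward
    -- kernel is the source law itself.
    (r := fun x _ => marginalX (efcfLaw δ) x)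
    (q := fun b => if b.1 = false ∧ b.2 = some false then 1 else 0)
    (κ := fun _ => 0) (αs := 0) (αx := 0) le_rfl le_rfl
    (fun x z y => rfl)
    (fun b => by split_ifs <;> norm_num)
    (fun _ _ => hsum) (fun x _ => (hP x).le) (fun _ => hsum.le)
    (by
      intro x
      simp [Fintype.sum_prod_type, Fintype.sum_option])
    (by
      intro x b _
      simp [(hP x).ne'])
    (by
      refine le_trans (le_of_eq ?_) h2
      simp [Fintype.sum_prod_type, Fintype.sum_option,
        surrogate_efcf_none hδ0, surrogate_efcf_some hδ1]
      ring)
    (by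
      refine le_trans (le_of_eq ?_) h1
      simp [Fintype.sum_prod_type, Fintype.sum_option, hamming]
      ring)
    (Or.inl rfl) (Or.inl rfl) (fun _ _ x _ h => absurd h (hP x).ne')
  exact ⟨by simpa using hR, W, hW⟩

/-! ### Region D4, where both constraints are active. -/

/-- The backward kernel `P(x | z, y)` of the test channel in region 4, extended to all `(z, y)`. -/
def r4Backward (δ ds dx : ℝ) (x : Option Bool) (b : Bool × Option Bool) : ℝ :=
  (1 - dx) * (if x = some (!b.1) then (ds - δ / 2) / (dx - ds + δ / 2) else 1) *
    (if x = b.2 then 1 else (dx - ds + δ / 2) / (1 - dx))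

/-- The factor `r4g` is `1 - dx` over the source mass, so the source law cancels and `(1 - dx) *
r4c` is revealed as the backward kernel on the support of the output law. -/
theorem marginalX_mul_r4Channel (hδ0 : 0 < δ) (hδ : δ < 1)
    (x : Option Bool) (b : Bool × Option Bool) :
    marginalX (efcfLaw δ) x * r4Channel δ ds dx x b
      = r4ZY δ ds dx b.1 b.2 * ((1 - dx) * r4c δ ds dx b.1 b.2 x) := by
  have h1δ : 1 - δ ≠ 0 := by linarith
  have := hδ0.ne'
  cases x <;> simp only [r4Channel, r4g, marginalX_efcf_none, marginalX_efcf_some, if_true,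
    reduceCtorEq, if_false] <;> field_simp

/-- Each supported output sees one source symbol from each of `G1`, `G2`, `G3`, with masses `1 -
dx`, `ds - δ / 2` and `dx - ds + δ / 2`, which add up to one. -/
theorem sum_r4c (hdx : dx < 1) (b : Bool × Option Bool) (hb : r4ZY δ ds dx b.1 b.2 ≠ 0) :
    ∑ x, (1 - dx) * r4c δ ds dx b.1 b.2 x = 1 := by
  have hc : 1 - dx ≠ 0 := by linarith
  rcases b with ⟨_ | _, _ | _ | _⟩ <;> simp [r4ZY] at hb <;>
    simp [Fintype.sum_option, r4c, G1, G2, G3] <;> field_simp <;> ring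

theorem outputLaw_r4Channel (hδ0 : 0 < δ) (hδ : δ < 1) (hdx : dx < 1) (b : Bool × Option Bool) :
    outputLaw (marginalX (efcfLaw δ)) (r4Channel δ ds dx) b = r4ZY δ ds dx b.1 b.2 :=
  outputLaw_eq_of_backward (q := fun b => r4ZY δ ds dx b.1 b.2)
    (marginalX_mul_r4Channel hδ0 hδ) (fun b hb => sum_r4c hdx b hb) b

theorem r4Channel_properties (hδ0 : 0 < δ) (hδ : δ < 1 / 3) (h : (ds, dx) ∈ D4 δ) :
    IsChannel (r4Channel δ ds dx) ∧
    ∑ x, ∑ b : Bool × Option Bool, marginalX (efcfLaw δ) x * r4Channel δ ds dx x b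
        * surrogateDistortion (efcfLaw δ) hamming x b.1 = ds ∧
    ∑ x, ∑ b : Bool × Option Bool, marginalX (efcfLaw δ) x * r4Channel δ ds dx x b
        * hamming x b.2 = dx := by
  obtain ⟨h1, h2, h3, h4⟩ := h
  simp only at h1 h2 h3 h4
  have hδ1 : δ < 1 := by linarith
  have hc : 0 < 1 - dx := by linarith
  have hc' := hc.ne'
  have hD : δ + 4 * dx - 2 * ds - 2 < 0 := by linarith
  -- The common denominator is made opaque so that `field_simp` clears it as an atom; it is
  -- negative, as are (weakly) both numerators of `r4ZY`.
  obtain ⟨D, hDdef⟩ : ∃ D, D = δ + 4 * dx - 2 * ds - 2 := ⟨_, rfl⟩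
  have hD' : D ≠ 0 := by linarith
  have h1δ : 1 - δ ≠ 0 := by linarith
  have hδ' := hδ0.ne'
  have hch : IsChannel (r4Channel δ ds dx) := by
    refine fun x => ⟨fun b => ?_, ?_⟩
    · unfold r4Channel
      refine mul_nonneg (mul_nonneg ?_ ?_) ?_
      · unfold r4ZY
        split_ifs
        · exact div_nonneg_of_nonpos (by linarith) hD.le
        · exact div_nonneg_of_nonpos (by linarith) hD.le
        · exact le_rfl
      · unfold r4g
        split_ifs
        · exact div_nonneg hc.le hδ0.le
        · exact div_nonneg (by linarith) (by linarith)
      · unfold r4c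
        split_ifs
        · exact zero_le_one
        · exact div_nonneg (by linarith) hc.le
        · exact div_nonneg (by linarith) hc.le
        · exact le_rfl
    · rcases x with _ | _ | _ <;>
        simp [Fintype.sum_prod_type, Fintype.sum_option, r4Channel, r4ZY, r4g, r4c, G1, G2, G3, ← hDdef] <;>
        field_simp <;> rw [hDdef] <;> ring
  refine ⟨hch, ?_, ?_⟩
  · rw [sum_surrogate_efcf hδ0 hδ1, (hch none).2]
    simp [Fintype.sum_option, r4Channel, r4ZY, r4g, r4c, G1, G2, G3, ← hDdef]
    field_simp
    rw [hDdef]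
    ring
  · rw [sum_hamming_efcf]
    simp [r4Channel, r4ZY, r4g, r4c, G1, G2, G3, ← hDdef]
    field_simp
    rw [hDdef]
    ring

theorem efcf_region4 (hδ0 : 0 < δ) (hδ : δ < 1 / 3) (h : (ds, dx) ∈ D4 δ) :
    efcfR δ ds dx = Real.binEntropy δ + (1 - δ) * Real.log 2
        - entropy3 (ds - δ / 2) (dx - ds + δ / 2) (1 - dx) ∧
    EfcfOptimal δ ds dx (r4Channel δ ds dx) := by
  obtain ⟨hch, hEs, hEx⟩ := r4Channel_properties hδ0 hδ h
  obtain ⟨h1, h2, h3, h4⟩ := h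
  simp only at h1 h2 h3 h4
  have hδ1 : δ < 1 := by linarith
  have hc : 0 < 1 - dx := by linarith
  have hP := marginalX_efcf_pos hδ0 hδ1
  have hfeas : IsFeasible (efcfLaw δ) hamming (hamming : Option Bool → Option Bool → ℝ) ds dx
    (r4Channel δ ds dx) := ⟨hch, hEs.le, hEx.le⟩
  have hent := efcf_entropy hδ1
  -- Write `t = ds - δ / 2`, `b = dx - ds + δ / 2`, `c = 1 - dx`, so `t + b + c = 1` and D4 gives `0
  -- ≤ t ≤ b`. If `b = 0` then `t = 0` and `dx = 0`: `Y` must reproduce `X`, and `r4Backward` would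
  -- divide by zero, so the identity kernel is used instead.
  rcases (show 0 ≤ dx - ds + δ / 2 by linarith).eq_or_lt with hb | hb
  · have hdx : dx = 0 := by linarith
    have hds : ds = δ / 2 := by linarith
    subst hdx hds
    obtain ⟨hopt, hR⟩ := isOptimal_of_certificate hP le_rfl le_rfl hfeas
      (r := fun x b => if x = b.2 then 1 else 0) (q := fun b => r4ZY δ (δ / 2) 0 b.1 b.2)
      (κ := fun x => - Real.log (marginalX (efcfLaw δ) x))
      (by
        rintro x ⟨z, y⟩
        rw [marginalX_mul_r4Channel hδ0 hδ1]
        rcases x with _ | _ | _ <;> rcases z with _ | _ <;> rcases y with _ | _ | _ <;>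
          simp [r4ZY, r4c, G1, G2, G3])
      (by simp)
      (by
        intro x b
        split_ifs <;> norm_num)
      (by simp)
      (by
        intro x b hne
        have : x = b.2 := by simpa using hne
        simp [this])
      (Or.inl rfl) (Or.inl rfl)
      (by
        rintro W' hW' x ⟨z, y⟩ hne
        exact channel_eq_zero_of_hamming hδ0 hδ1 hW' le_rfl (by simpa using hne) z)
    refine ⟨?_, hopt⟩
    change rateDistortion _ _ _ _ _ = _
    rw [hR, ← hent]
    simp [Fintype.sum_option, entropy3]
    ring
  · have ht : 0 ≤ ds - δ / 2 := by linarith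
    have hbc : dx - ds + δ / 2 ≤ 1 - dx := by linarith
    have hc' := hc.ne'
    have hb' := hb.ne'
    have hb2 : δ / 2 + dx - ds = dx - ds + δ / 2 := by ring
    -- This is subnormalisation at the unused outputs where `y` is the bit opposite to `z`. Since `t
    -- + b + c = 1`, it is `c t + 2 b² ≤ b (t + b + c)`, that is `0 ≤ (c - b) (b - t)`.
    have hkey : (1 - dx) * ((ds - δ / 2) / (dx - ds + δ / 2)) + 2 * (dx - ds + δ / 2) ≤ 1 := by
      rw [← mul_div_assoc, div_add' _ _ _ hb', div_le_one hb]
      nlinarith [mul_nonneg (sub_nonneg.2 hbc)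
        (show 0 ≤ (dx - ds + δ / 2) - (ds - δ / 2) by linarith)]
    have hcan : ∀ u : ℝ, (1 - dx) * (u / (1 - dx)) = u := fun u => mul_div_cancel₀ u hc'
    have hcan2 : (1 - dx) * ((ds - δ / 2) / (dx - ds + δ / 2))
        * ((dx - ds + δ / 2) / (1 - dx)) = ds - δ / 2 := by
      rw [mul_assoc, div_mul_div_cancel₀ hb', hcan]
    obtain ⟨hopt, hR⟩ := isOptimal_of_certificate hP (hfeas := hfeas)
      -- The two factors of `r4Backward` are `t / b` for misreading the bit and `b / c` for a
      -- Hamming error. Their negative logarithms are the multipliers, nonnegative because `t ≤ b ≤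
      -- c`; `κ` at the erasure again absorbs `αs / 2`.
      (αs := if ds - δ / 2 = 0 then 0
        else Real.log (dx - ds + δ / 2) - Real.log (ds - δ / 2))
      (αx := Real.log (1 - dx) - Real.log (dx - ds + δ / 2))
      (r := r4Backward δ ds dx) (q := fun b => r4ZY δ ds dx b.1 b.2)
      (κ := fun x => Real.log (1 - dx) + (if x = none then (if ds - δ / 2 = 0 then 0
        else Real.log (dx - ds + δ / 2) - Real.log (ds - δ / 2)) / 2 else 0)
        - Real.log (marginalX (efcfLaw δ) x))
      (by
        split_ifs with h
        · exact le_rfl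
        · have : 0 < ds - δ / 2 := lt_of_le_of_ne ht (Ne.symm h)
          exact sub_nonneg.2 (Real.log_le_log this (by linarith)))
      (sub_nonneg.2 (Real.log_le_log hb hbc))
      (by
        rintro x ⟨z, y⟩
        rw [marginalX_mul_r4Channel hδ0 hδ1]
        rcases x with _ | _ | _ <;> rcases z with _ | _ <;> rcases y with _ | _ | _ <;>
          simp [r4ZY, r4c, G1, G2, G3, r4Backward, hb2, hcan, hcan2])
      (by
        rintro ⟨z, y⟩ hne
        rcases z with _ | _ <;> rcases y with _ | _ | _ <;> simp [r4ZY] at hne <;>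
          simp [Fintype.sum_option, r4Backward, hcan, hcan2] <;> ring)
      (by
        intro x b
        unfold r4Backward
        refine mul_nonneg (mul_nonneg hc.le ?_) ?_
        · split_ifs
          · exact div_nonneg ht hb.le
          · exact zero_le_one
        · split_ifs
          · exact zero_le_one
          · exact div_nonneg hb.le hc.le)
      (by
        rintro ⟨z, y⟩
        rcases z with _ | _ <;> rcases y with _ | _ | _ <;>
          simp [Fintype.sum_option, r4Backward, hcan, hcan2] <;> linarith)
      (by
        rintro x ⟨z, y⟩ hne
        rw [Real.log_div hne (hP x).ne']
        unfold r4Backward at *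
        have hne1 := left_ne_zero_of_mul hne
        rw [Real.log_mul hne1 (right_ne_zero_of_mul hne),
          Real.log_mul hc' (right_ne_zero_of_mul hne1)]
        have hf2 : Real.log (if x = y then 1 else (dx - ds + δ / 2) / (1 - dx))
            = - ((Real.log (1 - dx) - Real.log (dx - ds + δ / 2)) * hamming x y) := by
          unfold hamming
          split_ifs
          · simp
          · rw [Real.log_div hb' hc']
            ring
        dsimp only
        rw [hf2]
        rcases x with _ | a
        · rw [surrogate_efcf_none hδ0]
          simp only [reduceCtorEq, if_false, if_true, Real.log_one]
          ring
        · rw [surrogate_efcf_some hδ1]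
          by_cases haz : a = z
          · subst haz
            simp
            ring
          · have haz' : a = !z := by cases a <;> cases z <;> simp_all
            have ht0 : ds - δ / 2 ≠ 0 := by
              intro h0
              apply right_ne_zero_of_mul hne1
              simp [haz', h0]
            simp only [haz', if_true, ht0, if_false, reduceCtorEq, Bool.not_eq_self]
            rw [Real.log_div ht0 hb']
            ring)
      (Or.inr hEs) (Or.inr hEx)
      (by
        rintro W' hW' x ⟨z, y⟩ h0
        -- The Hamming factor never vanishes, so a zero of `r` comes from the misreading factor and
        -- forces `ds = δ / 2`.
        have hne : ∀ P : Prop, ∀ _ : Decidable P,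
            (if P then 1 else (dx - ds + δ / 2) / (1 - dx)) ≠ 0 := by
          intro P _
          split_ifs
          · exact one_ne_zero
          · exact div_ne_zero hb' hc'
        have h5 := (mul_eq_zero.1 ((mul_eq_zero.1 h0).resolve_right (hne _ _))).resolve_left hc'
        split_ifs at h5 with hx
        · have hx' : x = some (!z) := hx
          subst hx'
          have ht0 : ds - δ / 2 = 0 := (div_eq_zero_iff.1 h5).resolve_right hb'
          exact channel_eq_zero_of_semantic hδ0 hδ1 hW' (by linarith) (by simp) y
        · exact absurd h5 one_ne_zero)
    refine ⟨?_, hopt⟩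
    change rateDistortion _ _ _ _ _ = _
    rw [hR, ← hent]
    simp only [Fintype.sum_option, Fintype.sum_bool, marginalX_efcf_none, marginalX_efcf_some,
      if_true, reduceCtorEq, if_false, entropy3, Real.negMulLog]
    split_ifs with h
    · rw [h]
      have : dx = dx - ds + δ / 2 := by linarith
      simp only [Real.log_zero]
      linear_combination (-Real.log (1 - dx) + Real.log (dx - ds + δ / 2)) * this
        + Real.log (1 - dx) * h
    · ring

end Efcf

end SemanticRD

end

open SemanticRD
theorem theorem4 (δ ds dx : ℝ) (hδ0 : 0 < δ) (hδ : δ < 1 / 3)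
    (hds : δ / 2 ≤ ds) (hdx : 0 ≤ dx) :
    ((ds, dx) ∈ D1 δ →
      efcfR δ ds dx = Real.binEntropy δ + (1 - δ) * Real.log 2
          - Real.binEntropy dx - dx * Real.log 2 ∧
      EfcfOptimalJoint δ ds dx
        (fun x z y => r1Y δ dx y * r1XgivenY dx x y * r1ZgivenY z y)) ∧
    ((ds, dx) ∈ D2 δ →
      efcfR δ ds dx = (1 - δ) * (Real.log 2 - Real.binEntropy ((dx - δ) / (1 - δ))) ∧
      EfcfOptimalJoint δ ds dx
        (fun x z y => r2Y y * r2XgivenY δ dx x y * r2ZgivenY z y)) ∧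
    ((ds, dx) ∈ D3 δ →
      efcfR δ ds dx = (1 - δ) * (Real.log 2 - Real.binEntropy ((ds - δ / 2) / (1 - δ))) ∧
      EfcfOptimalJoint δ ds dx
        (fun x z y => r3Z z * r3XgivenZ δ ds x z * r3YgivenZ y z)) ∧
    ((ds, dx) ∈ D4 δ →
      efcfR δ ds dx = Real.binEntropy δ + (1 - δ) * Real.log 2
          - entropy3 (ds - δ / 2) (dx - ds + δ / 2) (1 - dx) ∧
      EfcfOptimal δ ds dx (r4Channel δ ds dx) ∧
      ∀ z y, outputLaw (marginalX (efcfLaw δ)) (r4Channel δ ds dx) (z, y)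
        = r4ZY δ ds dx z y) ∧
    ((ds, dx) ∈ D5 δ →
      efcfR δ ds dx = 0 ∧ ∃ W, EfcfOptimal δ ds dx W) :=
  ⟨efcf_region1 hδ0 hδ, efcf_region2 hδ0 hδ, efcf_region3 hδ0 hδ,
    fun h => ⟨(efcf_region4 hδ0 hδ h).1, (efcf_region4 hδ0 hδ h).2, fun z y =>
      outputLaw_r4Channel hδ0 (by linarith)
        (by obtain ⟨-, h2, -, h4⟩ := h; simp only at h2 h4; linarith) (z, y)⟩,
    efcf_region5 hδ0 hδ⟩
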